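/- \textbf{Definitions.} A characteristic string is $w=w_1\dots w_T\in\{0,1\}^T$; a slot $i\in\{1,\dots,T\}$ is honest if $w_i=0$. A \emph{fork} $F\vdash w$ is a rooted tree with edges directed away from the root and a labeling $\ell$ of its vertices by $\{0,1,\dots,T\}$ such that: the root has label $0$; labels strictly increase along directed paths; every honest slot is the label of exactly one vertex; and if $i<j$ are honest slots, then the vertex labeled $i$ has strictly smaller depth than the vertex labeled $j$. A \emph{tine} $t$ is a directed path starting at the root; its length is its number of edges, and $\ell(t)$ is the label of its last vertex. A tine $t$ is \emph{viable} if its length is at least the depth of every vertex $v$ whose label is an honest slot with $\ell(v)\le \ell(t)$. For $k\in\mathbb N$, the string $w$ satisfies \emph{$k$-slot-CP} (resp. \emph{$k$-CP}) if for every fork $F\vdash w$ and all viable tines $t_1,t_2$ of $F$ with $\ell(t_1)\le\ell(t_2)$, the part of $t_1$ with labels at most $\ell(t_1)-k$ (resp. $t_1$ with its last $k$ vertices deleted) is a prefix of $t_2$; otherwise $w$ \emph{violates} the property. A random variable $W=(W_1,\dots,W_T)$ with values in $\{0,1\}^T$ satisfies the \emph{$\epsilon$-martingale condition} if $\mathbb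 E[W_t\mid W_1,\dots,W_{t-1}]\le(1-\epsilon)/2$ almost surely for every $t\in\{1,\dots,T\}$. \textbf{Theorem.} There are absolute constants $c>0$ and $C\in[0,1]$ such that for all $\epsilon\in(0,1)$, all $T,k\in\mathbb N$ (including $0$), and every random variable $w\in\{0,1\}^T$ that satisfies the $\epsilon$-martingale condition, \[ \Pr[w\text{ violates }k\text{-CP}]\;\le\;\Pr[w\text{ violates }k\text{-slot-CP}]\;\le\;T\cdot\exp\bigl(-c\,\epsilon^3(1-C\epsilon)\,k\bigr). \] -/

import Mathlib

open MeasureTheory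

/-- A rooted tree, every edge of which is directed away from the root: `parent v` is the tail of
the unique edge that ends at the vertex `v ≠ root` (the value `parent root = root` is a convention),
and every vertex can be reached from the root. -/
structure BlockTree where
  /-- The vertices. -/
  V : Type
  root : V
  parent : V → V
  parent_root : parent root = root
  exists_iterate_parent : ∀ v, ∃ d : ℕ, parent^[d] v = root

namespace BlockTree

/-- There is an edge from `u` to `v`. -/
def Edge (F : BlockTree) (u v : F.V) : Prop :=
  v ≠ F.root ∧ F.parent v = u

open Classical in
/-- The depth of `v`: the number of edges of the path from the root to `v`. -/
noncomputable def depth (F : BlockTree) (v : F.V) : ℕ :=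
  Nat.find (F.exists_iterate_parent v)

end BlockTree

/-- For a characteristic string `w = w₁ … wₙ` (`true` is `1`, `false` is `0`, and `w i` is the
letter with the number `i + 1`), the slot `s ∈ {1, …, n}` is honest if `w_s = 0`. -/
def HonestSlot {n : ℕ} (w : Fin n → Bool) (s : ℕ) : Prop :=
  ∃ i : Fin n, (i : ℕ) + 1 = s ∧ w i = false

/-- A fork for the characteristic string `w`. -/
structure Fork {n : ℕ} (w : Fin n → Bool) extends BlockTree where
  /-- The labeling by `{0, 1, …, n}`. -/
  label : V → ℕ
  label_le : ∀ v, label v ≤ n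
  /-- (F1) The root has label `0`. -/
  label_root : label root = 0
  /-- (F2) Labels strictly increase along directed paths. -/
  label_lt : ∀ u v, toBlockTree.Edge u v → label u < label v
  /-- (F3) Every honest slot is the label of exactly one vertex. -/
  existsUnique_honest : ∀ s, HonestSlot w s → ∃! v, label v = s
  /-- (F4) The depths of honest vertices strictly increase with their slots. -/
  depth_lt : ∀ u v, HonestSlot w (label u) → HonestSlot w (label v) → label u < label v →
    toBlockTree.depth u < toBlockTree.depth v

/-- A tine: a directed path that starts at the root, given by the list of its vertices. -/
structure Tine {n : ℕ} {w : Fin n → Bool} (F : Fork w) where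
  verts : List F.V
  head_eq : verts.head? = some F.root
  chain : verts.IsChain F.Edge

namespace Tine

variable {n : ℕ} {w : Fin n → Bool} {F : Fork w}

theorem verts_ne_nil (t : Tine F) : t.verts ≠ [] := by
  intro h
  have := t.head_eq
  simp [h] at this

/-- The number of edges of the path. -/
def length (t : Tine F) : ℕ := t.verts.length - 1

/-- The label `ℓ(t)` of the vertex at which the tine `t` terminates. -/
def label (t : Tine F) : ℕ := F.label (t.verts.getLast t.verts_ne_nil)

/-- A tine is viable if it is at least as long as the depth of every honest vertex `v` with
`ℓ(v) ≤ ℓ(t)`. -/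
def Viable (t : Tine F) : Prop :=
  ∀ v : F.V, HonestSlot w (F.label v) → F.label v ≤ t.label → F.depth v ≤ t.length

/-- The portion of the tine `t` that is labeled with the slots `0, …, ℓ(t) - k`. -/
def trimSlots (t : Tine F) (k : ℕ) : List F.V :=
  t.verts.filter (fun v => F.label v + k ≤ t.label)

/-- The tine `t` without its last `k` blocks (vertices). -/
def trimBlocks (t : Tine F) (k : ℕ) : List F.V :=
  t.verts.take (t.verts.length - k)

end Tine

/-- A fork satisfies the slot-deletion common prefix property with parameter `k`. -/
def Fork.SatisfiesSlotCP {n : ℕ} {w : Fin n → Bool} (F : Fork w) (k : ℕ) : Prop :=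
  ∀ t₁ t₂ : Tine F, t₁.Viable → t₂.Viable → t₁.label ≤ t₂.label →
    t₁.trimSlots k <+: t₂.verts

/-- A fork satisfies the block-deletion common prefix property with parameter `k`. -/
def Fork.SatisfiesCP {n : ℕ} {w : Fin n → Bool} (F : Fork w) (k : ℕ) : Prop :=
  ∀ t₁ t₂ : Tine F, t₁.Viable → t₂.Viable → t₁.label ≤ t₂.label →
    t₁.trimBlocks k <+: t₂.verts

/-- The string `w` violates `k`-slot-CP: some fork for `w` does not satisfy it. -/
def ViolatesSlotCP (k : ℕ) {n : ℕ} (w : Fin n → Bool) : Prop :=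
  ¬ ∀ F : Fork w, F.SatisfiesSlotCP k

/-- The string `w` violates `k`-CP: some fork for `w` does not satisfy it. -/
def ViolatesCP (k : ℕ) {n : ℕ} (w : Fin n → Bool) : Prop :=
  ¬ ∀ F : Fork w, F.SatisfiesCP k

/-- The `ε`-martingale condition for a random variable `W = (W₁, …, W_T)` with values in
`{0,1}^T`: almost surely `E[W_t | W_1, …, W_{t-1}] ≤ (1 - ε) / 2`, for every `t`. The conditioning
is on the σ-algebra that the earlier coordinates generate. -/
def MartingaleCondition (ε : ℝ) {T : ℕ} {Ω : Type*} [MeasurableSpace Ω] (P : Measure Ω)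
    (W : Ω → Fin T → Bool) : Prop :=
  ∀ t : Fin T,
    P[fun ω => if W ω t = true then (1 : ℝ) else 0 |
        MeasurableSpace.comap (fun ω (j : {j : Fin T // j < t}) => W ω j) inferInstance]
      ≤ᵐ[P] fun _ => (1 - ε) / 2

/-!
The walk of a characteristic string steps up at honest slots and down at adversarial ones. A slot is
a *cut* if the walk makes a strict record there and never falls back: all earlier values are less
than all later ones. Then every viable tine that reaches the slot contains its honest vertex
(`Tine.exists_mem_of_isCut`): a tine that avoids it could use only adversarial vertices from its
last honest vertex (or the root) before the cut until its next honest vertex or its end, while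
honest slots, each of which raises the depth that is required, hold a strict majority in that
interval. Two viable tines share everything up to a common vertex, so a violation of `k`-slot-CP
produces `k + 1` consecutive slots without a cut (`ViolatesSlotCP.exists_window`). There are at
most `T` such windows, and the union bound gives the factor `T`.

For a fixed window, the letters are read by an automaton (`CutSearch`) that waits for a record of
the walk, takes it as a candidate for a cut, drops the candidate when the walk falls back, and then
waits for the next record. If a candidate survives to the end, the window contains a cut. A waiting
state at distance `g` from the record has potential `κ ^ r * z ^ g`, where `r` letters of the window
are left, `z = 1 + ε ^ 2 / 8` and `κ = E[z ^ (-X)] ≤ exp (-ε ^ 3 / 18)` for a step `X` of the walk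
with bias `ε`. A candidate has a potential `κ ^ r * Ψ d e` that solves the corresponding linear
recurrence. This potential is a supermartingale for independent steps
(`PotentialParams.potential_step`) and is no less after a down step than after an up step
(`PotentialParams.potential_next_mono`); the second fact extends the first to every string that
satisfies the martingale condition. So the window has no cut with probability at most `(2 / ε) * κ ^
(k + 1)`; the factor `2 / ε` is absorbed in `le_mul_exp_of_le`, because a violation needs `T > k`.
-/

/-! ### Vertices of a tine -/

namespace BlockTree

theorem depth_root (F : BlockTree) : F.depth F.root = 0 := by
  simp [depth, Nat.find_eq_zero]

theorem depth_of_ne_root (F : BlockTree) {v : F.V} (h : v ≠ F.root) :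
    F.depth v = F.depth (F.parent v) + 1 := by
  classical
  exact Nat.find_comp_succ (F.exists_iterate_parent v) (F.exists_iterate_parent (F.parent v)) h

end BlockTree

namespace Tine

variable {n : ℕ} {w : Fin n → Bool} {F : Fork w}

theorem length_pos (t : Tine F) : 0 < t.verts.length :=
  List.length_pos_iff.2 t.verts_ne_nil

theorem getElem_zero (t : Tine F) : t.verts[0]'t.length_pos = F.root := by
  have h := t.head_eq
  rw [List.head?_eq_getElem?, List.getElem?_eq_getElem t.length_pos] at h
  exact Option.some.inj h

theorem edge_getElem (t : Tine F) {i : ℕ} (hi : i + 1 < t.verts.length) :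
    F.Edge t.verts[i] t.verts[i + 1] :=
  List.isChain_iff_getElem.1 t.chain i hi

theorem depth_getElem (t : Tine F) {i : ℕ} (hi : i < t.verts.length) :
    F.depth t.verts[i] = i := by
  induction i with
  | zero => rw [t.getElem_zero, BlockTree.depth_root]
  | succ i ih =>
    obtain ⟨h1, h2⟩ := t.edge_getElem hi
    rw [F.depth_of_ne_root h1, h2, ih]

theorem label_getElem_add_le (t : Tine F) {i j : ℕ} (hij : i ≤ j) (hj : j < t.verts.length) :
    F.label t.verts[i] + (j - i) ≤ F.label t.verts[j] := by
  induction j, hij using Nat.le_induction with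
  | base => simp
  | succ j hij ih =>
    have := F.label_lt _ _ (t.edge_getElem hj)
    have := ih (by omega)
    omega

theorem label_eq_getElem (t : Tine F) :
    t.label = F.label (t.verts[t.length]'(by have := t.length_pos; unfold length; omega)) := by
  simp [label, length, List.getLast_eq_getElem]

/-- The vertices of a tine up to a given vertex are determined by that vertex. -/
theorem getElem_eq_iterate_parent (t : Tine F) {i j : ℕ} (hij : i ≤ j)
    (hj : j < t.verts.length) : t.verts[i] = F.parent^[j - i] t.verts[j] := by
  induction j, hij using Nat.le_induction with
  | base => simp
  | succ j hij ih =>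
    rw [Nat.succ_sub hij, Function.iterate_succ_apply, (t.edge_getElem hj).2]
    exact ih (by omega)

theorem take_eq_of_mem (t₁ t₂ : Tine F) {x : F.V} (h₁ : x ∈ t₁.verts) (h₂ : x ∈ t₂.verts) :
    t₁.verts.take (F.depth x + 1) = t₂.verts.take (F.depth x + 1) := by
  obtain ⟨i, hi, rfl⟩ := List.getElem_of_mem h₁
  obtain ⟨j, hj, hx⟩ := List.getElem_of_mem h₂
  have hji : j = i := by rw [← t₂.depth_getElem hj, hx, t₁.depth_getElem hi]
  subst hji
  rw [t₁.depth_getElem hi]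
  refine List.ext_getElem (by simp; omega) fun l h _ => ?_
  have hl : l ≤ j := by simp at h; omega
  rw [List.getElem_take, List.getElem_take, t₁.getElem_eq_iterate_parent hl hi,
    t₂.getElem_eq_iterate_parent hl hj, hx]

theorem pairwise_label (t : Tine F) : t.verts.Pairwise fun u v => F.label u < F.label v := by
  rw [List.pairwise_iff_getElem]
  intro i j hi hj hij
  have := t.label_getElem_add_le hij.le hj
  omega

end Tine

theorem List.filter_prefix_of_pairwise {α : Type*} {R : α → α → Prop} {p : α → Bool}
    {l : List α} (hl : l.Pairwise R) (hp : ∀ a b, R a b → p b = true → p a = true) :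
    l.filter p <+: l := by
  induction l with
  | nil => simp
  | cons a l ih =>
    rw [List.pairwise_cons] at hl
    by_cases ha : p a = true
    · rw [List.filter_cons_of_pos ha, List.prefix_cons_inj]
      exact ih hl.2
    · have : l.filter p = [] := by
        rw [List.filter_eq_nil_iff]
        exact fun b hb hpb => ha (hp a b (hl.1 b hb) hpb)
      simp [List.filter_cons_of_neg ha, this]

namespace Tine

variable {n : ℕ} {w : Fin n → Bool} {F : Fork w}

/-- Two tines that share a vertex `x` agree up to `x`, hence on every slot up to `ℓ(x)`. -/
theorem trimSlots_prefix_of_mem (t₁ t₂ : Tine F) {x : F.V} {k : ℕ} (h₁ : x ∈ t₁.verts)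
    (h₂ : x ∈ t₂.verts) (hk : t₁.label ≤ F.label x + k) : t₁.trimSlots k <+: t₂.verts := by
  have hdrop : (t₁.verts.drop (F.depth x + 1)).filter
      (fun v => F.label v + k ≤ t₁.label) = [] := by
    rw [List.filter_eq_nil_iff]
    intro v hv
    obtain ⟨i, hi, rfl⟩ := List.getElem_of_mem h₁
    rw [t₁.depth_getElem hi] at hv
    obtain ⟨j, hj, rfl⟩ := List.getElem_of_mem hv
    rw [List.length_drop] at hj
    have := t₁.label_getElem_add_le (i := i) (j := i + 1 + j) (by omega) (by omega)
    simp only [List.getElem_drop, decide_eq_true_eq]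
    omega
  have htrim : t₁.trimSlots k = (t₁.verts.take (F.depth x + 1)).filter
      (fun v => F.label v + k ≤ t₁.label) := by
    conv_lhs => rw [trimSlots, ← List.take_append_drop (F.depth x + 1) t₁.verts,
      List.filter_append, hdrop, List.append_nil]
  rw [htrim]
  refine (List.filter_prefix_of_pairwise (t₁.pairwise_label.sublist (List.take_sublist _ _))
    ?_).trans ?_
  · intro a b hab hb
    simp only [decide_eq_true_eq] at hb ⊢
    omega
  · rw [take_eq_of_mem t₁ t₂ h₁ h₂]
    exact List.take_prefix _ _

/-- Labels are distinct along a tine, so `k` blocks span at least `k` slots. -/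
theorem trimBlocks_prefix_trimSlots (t : Tine F) (k : ℕ) : t.trimBlocks k <+: t.trimSlots k := by
  have htake : (t.trimBlocks k).filter (fun v => F.label v + k ≤ t.label) = t.trimBlocks k := by
    rw [List.filter_eq_self]
    intro v hv
    obtain ⟨i, hi, rfl⟩ := List.getElem_of_mem hv
    simp only [trimBlocks, List.length_take] at hi
    have := t.label_getElem_add_le (i := i) (j := t.length) (by unfold length; omega)
      (by unfold length; omega)
    rw [← t.label_eq_getElem] at this
    simp only [trimBlocks, List.getElem_take, decide_eq_true_eq]
    unfold length at this
    omega
  rw [← htake, trimSlots]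
  conv_rhs => rw [← List.take_append_drop (t.verts.length - k) t.verts, List.filter_append]
  exact List.prefix_append _ _

end Tine

theorem ViolatesCP.violatesSlotCP {k n : ℕ} {w : Fin n → Bool} (h : ViolatesCP k w) :
    ViolatesSlotCP k w := fun hs =>
  h fun F t₁ t₂ h₁ h₂ h₁₂ => (t₁.trimBlocks_prefix_trimSlots k).trans (hs F t₁ t₂ h₁ h₂ h₁₂)

/-! ### The walk of a characteristic string and its cuts -/

/-- The letter with index `i`, which belongs to the slot `i + 1`; it is `false` past the end. -/
def letter {n : ℕ} (w : Fin n → Bool) (i : ℕ) : Bool :=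
  if h : i < n then w ⟨i, h⟩ else false

/-- The number of letters equal to `b` among the first `i` ones. -/
def letterCount {n : ℕ} (w : Fin n → Bool) (b : Bool) (i : ℕ) : ℕ :=
  Nat.count (fun j => letter w j = b) i

/-- The walk that goes up at each honest slot and down at each adversarial slot. -/
def walk {n : ℕ} (w : Fin n → Bool) (i : ℕ) : ℤ :=
  (letterCount w false i : ℤ) - letterCount w true i

/-- The letter with index `s` is a cut if each value of the walk up to time `s` is less than each
value after time `s`. Equivalently, honest slots hold a strict majority in every interval of slots
that contains `s + 1`. -/
def IsCut {n : ℕ} (w : Fin n → Bool) (s : ℕ) : Prop :=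
  s < n ∧ ∀ i j, i ≤ s → s < j → j ≤ n → walk w i < walk w j

section Walk

variable {n : ℕ} (w : Fin n → Bool)

theorem letterCount_succ (b : Bool) (i : ℕ) :
    letterCount w b (i + 1) = letterCount w b i + if letter w i = b then 1 else 0 :=
  Nat.count_succ _ _

theorem letterCount_mono (b : Bool) : Monotone (letterCount w b) :=
  Nat.count_monotone _

theorem walk_succ (i : ℕ) : walk w (i + 1) = walk w i + if letter w i = true then -1 else 1 := by
  unfold walk
  rw [letterCount_succ, letterCount_succ]
  cases letter w i <;> simp <;> ring

theorem honestSlot_succ_iff (i : ℕ) : HonestSlot w (i + 1) ↔ i < n ∧ letter w i = false := by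
  constructor
  · rintro ⟨j, hj, h⟩
    obtain rfl : (j : ℕ) = i := by omega
    exact ⟨j.2, by simp [letter, h]⟩
  · rintro ⟨hi, h⟩
    exact ⟨⟨i, hi⟩, rfl, by simpa [letter, hi] using h⟩

end Walk

/-! ### Cuts lie on every viable tine -/

section Viable

variable {n : ℕ} {w : Fin n → Bool} (F : Fork w)

/-- An anchor is a vertex that is honest or the root; anchors have strictly increasing depths. -/
def Fork.IsAnchor (u : F.V) : Prop :=
  u = F.root ∨ HonestSlot w (F.label u)

/-- Past an anchor, each honest slot adds at least one to the depth reached by anchors. -/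
theorem Fork.exists_anchor_depth {u : F.V} (hu : F.IsAnchor u) {b : ℕ} (hb : F.label u ≤ b)
    (hbn : b ≤ n) :
    ∃ v, F.IsAnchor v ∧ F.label v ≤ b ∧
      F.depth u + letterCount w false b ≤ F.depth v + letterCount w false (F.label u) := by
  induction b, hb using Nat.le_induction with
  | base => exact ⟨u, hu, le_rfl, le_rfl⟩
  | succ b hb ih =>
    obtain ⟨v, hv, hvb, hd⟩ := ih (by omega)
    rw [letterCount_succ]
    by_cases hl : letter w b = false
    · have hh : HonestSlot w (b + 1) := (honestSlot_succ_iff w b).2 ⟨by omega, hl⟩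
      obtain ⟨x, hx, -⟩ := F.existsUnique_honest _ hh
      refine ⟨x, Or.inr (hx ▸ hh), hx.le, ?_⟩
      have hlt : F.depth v < F.depth x := by
        rcases hv with rfl | hv
        · have hne : x ≠ F.root := by
            rintro rfl
            rw [F.label_root] at hx
            omega
          rw [F.depth_of_ne_root hne, F.depth_root]
          omega
        · exact F.depth_lt _ _ hv (hx ▸ hh) (by omega)
      simp only [hl, if_true]
      omega
    · exact ⟨v, hv, by omega, by simpa [hl] using hd⟩

variable {F}

/-- If a tine avoids the slot of a cut, then beyond that slot it carries only adversarial
vertices: its depth there is bounded by that of some anchor before the cut plus the number of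
adversarial slots since, and a later honest vertex would have to be deeper than that. -/
theorem Tine.exists_anchor_of_avoids_cut (t : Tine F) {s : ℕ} (hs : IsCut w s)
    (ht : ∀ v ∈ t.verts, F.label v ≠ s + 1) {i : ℕ} (hi : i < t.verts.length) :
    ∃ u, F.IsAnchor u ∧ F.label u ≤ s ∧ F.label u ≤ F.label t.verts[i] ∧
      i + letterCount w true (F.label u) ≤
        F.depth u + letterCount w true (F.label t.verts[i]) := by
  induction i with
  | zero =>
    refine ⟨F.root, Or.inl rfl, ?_, ?_, ?_⟩ <;> simp [F.label_root, t.getElem_zero]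
  | succ i ih =>
    obtain ⟨u, hu, hus, hui, hd⟩ := ih (by omega)
    have hlt := F.label_lt _ _ (t.edge_getElem hi)
    have hne := ht _ (List.getElem_mem hi)
    have hdep := t.depth_getElem hi
    have hle := F.label_le t.verts[i + 1]
    generalize t.verts[i + 1] = v at *
    obtain ⟨b, hb⟩ : ∃ b, F.label v = b + 1 := ⟨F.label v - 1, by omega⟩
    have hmono : letterCount w true (F.label t.verts[i]) ≤ letterCount w true b :=
      letterCount_mono w true (by omega)
    by_cases hv : HonestSlot w (F.label v)
    · by_cases hvs : F.label v ≤ s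
      · exact ⟨v, Or.inr hv, hvs, le_rfl, by omega⟩
      · exfalso
        have hcut := hs.2 (F.label u) b hus (by omega) (by omega)
        obtain ⟨x, hx, hxb, hxd⟩ := F.exists_anchor_depth hu (b := b) (by omega) (by omega)
        have hlt : F.depth x < F.depth v := by
          rcases hx with rfl | hx
          · rw [F.depth_root]
            omega
          · exact F.depth_lt _ _ hx hv (by omega)
        unfold walk at hcut
        omega
    · refine ⟨u, hu, hus, by omega, ?_⟩
      have hl : letter w b = true := by
        rw [hb, honestSlot_succ_iff] at hv
        by_contra hl
        exact hv ⟨by omega, by simpa using hl⟩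
      rw [hb, letterCount_succ, hl, if_pos rfl]
      omega

/-- Every viable tine that reaches the slot of a cut contains the honest vertex of that slot. -/
theorem Tine.exists_mem_of_isCut (t : Tine F) (hv : t.Viable) {s : ℕ} (hs : IsCut w s)
    (hts : s + 1 ≤ t.label) : ∃ v ∈ t.verts, F.label v = s + 1 := by
  by_contra! ht
  have hlen : t.length < t.verts.length := by
    have := t.length_pos
    unfold Tine.length
    omega
  obtain ⟨u, hu, hus, hut, hd⟩ := t.exists_anchor_of_avoids_cut hs ht hlen
  rw [← t.label_eq_getElem] at hut hd
  have htn : t.label ≤ n := F.label_le _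
  obtain ⟨x, hx, hxb, hxd⟩ := F.exists_anchor_depth hu hut htn
  have hle : F.depth x ≤ t.length := by
    rcases hx with rfl | hx
    · rw [F.depth_root]
      omega
    · exact hv x hx hxb
  have hcut := hs.2 (F.label u) t.label hus hts htn
  unfold walk at hcut
  omega

theorem IsCut.honestSlot {s : ℕ} (hs : IsCut w s) : HonestSlot w (s + 1) := by
  rw [honestSlot_succ_iff]
  refine ⟨hs.1, ?_⟩
  have h := hs.2 s (s + 1) le_rfl (by omega) hs.1
  rw [walk_succ] at h
  by_contra hl
  rw [Bool.eq_true_of_not_eq_false hl] at h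
  simp at h

/-- A violation of `k`-slot-CP forces a window of `k + 1` consecutive slots without a cut. -/
theorem ViolatesSlotCP.exists_window {k : ℕ} (h : ViolatesSlotCP k w) :
    ∃ m < n - k, ∀ s, m ≤ s → s < m + (k + 1) → ¬ IsCut w s := by
  unfold ViolatesSlotCP at h
  push Not at h
  obtain ⟨F, hF⟩ := h
  unfold Fork.SatisfiesSlotCP at hF
  push Not at hF
  obtain ⟨t₁, t₂, h₁, h₂, h₁₂, hp⟩ := hF
  have htn : t₁.label ≤ n := F.label_le _
  have hk : k < t₁.label := by
    by_contra! hk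
    refine hp (t₁.trimSlots_prefix_of_mem t₂ (x := F.root) ?_ ?_ (by omega)) <;>
    · rw [← Tine.getElem_zero]
      exact List.getElem_mem _
  refine ⟨t₁.label - k - 1, by omega, fun s hs hs' hcut => hp ?_⟩
  obtain ⟨x, hx, hxs⟩ := t₁.exists_mem_of_isCut h₁ hcut (by omega)
  obtain ⟨y, hy, hys⟩ := t₂.exists_mem_of_isCut h₂ hcut (by omega)
  obtain rfl : y = x := (F.existsUnique_honest _ hcut.honestSlot).unique hys hxs
  exact t₁.trimSlots_prefix_of_mem t₂ hx hy (by omega)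

end Viable

/-! ### An automaton that looks for cuts -/

/-- The state of the search for a cut, in terms of the walk. In `wait g` the walk is at most
`g` below its past maximum, and a new candidate arises at the next record. In `attempt d e`
there is a candidate, the walk is `d` above the level from which the candidate's letter stepped up
(the candidate dies when that level is reached again), and `e` bounds the height of the past
maximum over the level `d = 1`. -/
inductive CutSearch where
  | wait (g : ℕ)
  | attempt (d e : ℕ)

namespace CutSearch

/-- The effect of the letter with index `i`, when candidates are accepted among the letters
`m, …, m + K - 1`. After this window the state `wait` is absorbing. -/
def next (m K i : ℕ) : CutSearch → Bool → CutSearch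
  | wait g, true => if i < m + K then wait (g + 1) else wait g
  | wait (g + 1), false => if i < m + K then wait g else wait (g + 1)
  | wait 0, false => if m ≤ i ∧ i < m + K then attempt 1 0 else wait 0
  | attempt d e, true => if d = 1 then wait (e + 1) else attempt (d - 1) e
  | attempt d e, false => attempt (d + 1) (max e d)

/-- The state after `i` letters, with the window `m, …, m + K - 1`. -/
def state {n : ℕ} (w : Fin n → Bool) (m K : ℕ) : ℕ → CutSearch
  | 0 => wait 0
  | i + 1 => next m K i (state w m K i) (letter w i)

/-- The relation between the state after `i` letters and the walk up to time `i`. -/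
def Describes {n : ℕ} (w : Fin n → Bool) (m K i : ℕ) : CutSearch → Prop
  | wait g => i ≤ m + K → ∀ j ≤ i, walk w j ≤ walk w i + g
  | attempt d e => 1 ≤ d ∧ d ≤ e + 1 ∧ ∃ s, m ≤ s ∧ s < m + K ∧ s < i ∧
      (∀ j ≤ s, walk w j ≤ walk w s) ∧ (∀ j, s < j → j ≤ i → walk w s < walk w j) ∧
      walk w i = walk w s + d ∧ ∀ j ≤ i, walk w j ≤ walk w s + 1 + e

theorem describes_state {n : ℕ} (w : Fin n → Bool) (m K i : ℕ) :
    Describes w m K i (state w m K i) := by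
  induction i with
  | zero =>
    intro _ j hj
    obtain rfl : j = 0 := by omega
    simp
  | succ i ih =>
    rw [state]
    have hw := walk_succ w i
    -- a property of all `j ≤ i + 1` splits into `j ≤ i` and `j = i + 1`
    have hsplit : ∀ j, j ≤ i + 1 → j ≤ i ∨ j = i + 1 := fun j hj => by omega
    generalize state w m K i = σ at ih ⊢
    cases hl : letter w i <;> rw [hl] at hw <;>
      simp only [if_true, Bool.false_eq_true, if_false] at hw
    · match σ with
      | wait (g + 1) =>
        simp only [next]
        split_ifs with ho
        · intro _ j hj
          rcases hsplit j hj with hj | rfl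
          · have := ih ho.le j hj
            push_cast at this
            omega
          · omega
        · exact fun h => absurd h (by omega)
      | wait 0 =>
        simp only [next]
        split_ifs with ho
        · refine ⟨le_rfl, le_rfl, i, ho.1, ho.2, by omega,
            fun j hj => by simpa using ih ho.2.le j hj, fun j hj hj' => ?_, by simpa using hw,
            fun j hj => ?_⟩
          · obtain rfl : j = i + 1 := by omega
            omega
          · rcases hsplit j hj with hj | rfl
            · have := ih ho.2.le j hj
              push_cast at *
              omega
            · push_cast
              omega
        · intro hi j hj
          rcases hsplit j hj with hj | rfl
          · have := ih (by omega) j hj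
            push_cast at *
            omega
          · push_cast
            omega
      | attempt d e =>
        obtain ⟨hd, hde, s, hs, hs', hsi, hmax, hmin, hwi, hub⟩ := ih
        refine ⟨by omega, by omega, s, hs, hs', by omega, hmax, fun j hj hj' => ?_,
          by push_cast; omega, fun j hj => ?_⟩
        · rcases hsplit j hj' with hj' | rfl
          · exact hmin j hj hj'
          · omega
        · rcases hsplit j hj with hj | rfl
          · have := hub j hj
            omega
          · omega
    · match σ with
      | wait g =>
        simp only [next]
        split_ifs with ho
        · intro _ j hj
          rcases hsplit j hj with hj | rfl
          · have := ih ho.le j hj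
            push_cast
            omega
          · omega
        · exact fun h => absurd h (by omega)
      | attempt d e =>
        obtain ⟨hd, hde, s, hs, hs', hsi, hmax, hmin, hwi, hub⟩ := ih
        simp only [next]
        split_ifs with h1
        · intro _ j hj
          rcases hsplit j hj with hj | rfl
          · have := hub j hj
            push_cast
            omega
          · omega
        · refine ⟨by omega, by omega, s, hs, hs', by omega, hmax, fun j hj hj' => ?_,
            by omega, fun j hj => ?_⟩
          · rcases hsplit j hj' with hj' | rfl
            · exact hmin j hj hj'
            · omega
          · rcases hsplit j hj with hj | rfl
            · exact hub j hj
            · omega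

/-- A candidate that survives to the end is a cut. -/
theorem exists_isCut_of_state_eq_attempt {n : ℕ} {w : Fin n → Bool} {m K d e : ℕ}
    (h : state w m K n = attempt d e) : ∃ s, m ≤ s ∧ s < m + K ∧ IsCut w s := by
  have hσ := describes_state w m K n
  rw [h] at hσ
  obtain ⟨-, -, s, hs, hs', hsn, hmax, hmin, -, -⟩ := hσ
  exact ⟨s, hs, hs', hsn, fun i j hi hj hjn => (hmax i hi).trans_lt (hmin j hj hjn)⟩

theorem state_congr {n : ℕ} {w w' : Fin n → Bool} (m K : ℕ) {i : ℕ}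
    (h : ∀ j : Fin n, (j : ℕ) < i → w j = w' j) : state w m K i = state w' m K i := by
  induction i with
  | zero => rfl
  | succ i ih =>
    have hl : letter w i = letter w' i := by
      unfold letter
      split_ifs with hi
      · exact h ⟨i, hi⟩ (Nat.lt_succ_self i)
      · rfl
    rw [state, state, hl, ih fun j hj => h j (by omega)]

end CutSearch

/-! ### The potential -/

/-- The parameters of the potential. The walk steps up with probability `p` and down with
probability `q`, and `z > 1` is the factor by which each unit of distance to the next record raises
the potential. -/
structure PotentialParams where
  p : ℝ
  q : ℝ
  z : ℝ
  q_pos : 0 < q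
  add_eq_one : p + q = 1
  one_lt_z : 1 < z
  lt_p : q * z ^ 3 < p
  /-- The condition under which starting an attempt pays off. -/
  sub_one_le : z - 1 ≤ (1 - q / p * z ^ 3) ^ 2

namespace PotentialParams

variable (a : PotentialParams)

/-- The expected factor `E[z^{-X}]` of a step `X` of the walk. -/
noncomputable def κ : ℝ := a.p / a.z + a.q * a.z

/-- The ratio of the two step probabilities after tilting them by `z^{-X}`. -/
noncomputable def θ : ℝ := a.q / a.p * a.z ^ 2

/-- The potential that an attempt retains however high the walk climbs, as it may still fail after
raising the record and thereby the cost of waiting for the next one. -/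
noncomputable def α (e : ℕ) : ℝ :=
  (a.z - 1) * a.z ^ e * a.θ ^ (e + 2) / ((1 - a.θ) * (1 - a.z * a.θ))

/-- The potential of `CutSearch.attempt d e`, up to the discount for the time left. As a function
of `d` it is a combination of the two geometric solutions of `p f(d+1) + q f(d-1) = κ f(d)` that
takes the value `z ^ (e + 1)` of `CutSearch.wait (e + 1)` at `d = 0`. -/
noncomputable def Ψ (d e : ℕ) : ℝ :=
  a.z * (a.α e * a.z⁻¹ ^ d + (a.z ^ e - a.α e) * (a.θ * a.z⁻¹) ^ d)

theorem z_pos : 0 < a.z := zero_lt_one.trans a.one_lt_z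

theorem p_pos : 0 < a.p := (mul_pos a.q_pos (pow_pos a.z_pos 3)).trans a.lt_p

theorem θ_pos : 0 < a.θ := by
  have := a.q_pos; have := a.p_pos; have := a.z_pos
  unfold θ; positivity

theorem z_mul_θ_eq : a.z * a.θ = a.q / a.p * a.z ^ 3 := by unfold θ; ring

theorem z_mul_θ_lt_one : a.z * a.θ < 1 := by
  rw [z_mul_θ_eq, div_mul_eq_mul_div, div_lt_one a.p_pos]
  exact a.lt_p

theorem θ_lt_one : a.θ < 1 := by
  have := a.z_mul_θ_lt_one; have := a.θ_pos; have := a.one_lt_z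
  nlinarith

theorem q_mul_z_lt_p : a.q * a.z < a.p := by
  refine lt_of_le_of_lt ?_ a.lt_p
  exact mul_le_mul_of_nonneg_left (le_self_pow₀ a.one_lt_z.le (by norm_num)) a.q_pos.le

theorem one_sub_κ : 1 - a.κ = (a.z - 1) * (a.p - a.q * a.z) / a.z := by
  have := a.z_pos.ne'
  have h := a.add_eq_one
  unfold κ
  field_simp
  linear_combination (-a.z) * h

theorem κ_lt_one : a.κ < 1 := by
  have h : 0 < 1 - a.κ := by
    rw [one_sub_κ]
    exact div_pos (mul_pos (sub_pos.2 a.one_lt_z) (sub_pos.2 a.q_mul_z_lt_p)) a.z_pos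
  linarith

theorem κ_pos : 0 < a.κ := by
  have := a.q_pos; have := a.p_pos; have := a.z_pos
  unfold κ; positivity

theorem α_pos (e : ℕ) : 0 < a.α e := by
  have := sub_pos.2 a.one_lt_z; have := sub_pos.2 a.θ_lt_one
  have := sub_pos.2 a.z_mul_θ_lt_one; have := a.θ_pos; have := a.z_pos
  unfold α; positivity

theorem α_succ (e : ℕ) : a.α (e + 1) = a.z * a.θ * a.α e := by
  unfold α; ring

theorem α_zero_mul_le : a.α 0 * (1 - a.θ) ≤ a.z⁻¹ - a.θ := by
  have h1 := sub_pos.2 a.θ_lt_one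
  have h2 := sub_pos.2 a.z_mul_θ_lt_one
  have hz := a.z_pos
  have h3 : a.α 0 * (1 - a.θ) = (a.z - 1) * a.θ ^ 2 / (1 - a.z * a.θ) := by
    unfold α
    field_simp
  have h4 : a.z⁻¹ - a.θ = (1 - a.z * a.θ) / a.z := by
    field_simp
  rw [h3, h4, div_le_div_iff₀ h2 hz]
  have hs := a.sub_one_le
  rw [← z_mul_θ_eq] at hs
  have h5 : a.θ ^ 2 * a.z ≤ 1 := by
    have := a.θ_pos; have := a.θ_lt_one; have := a.z_mul_θ_lt_one
    nlinarith
  nlinarith [mul_le_mul_of_nonneg_left h5 (sub_pos.2 a.one_lt_z).le]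

theorem α_le (e : ℕ) : a.α e ≤ a.z ^ e := by
  induction e with
  | zero =>
    have h1 := a.α_zero_mul_le
    have h2 := sub_pos.2 a.θ_lt_one
    have h3 : a.z⁻¹ ≤ 1 := inv_le_one_of_one_le₀ a.one_lt_z.le
    rw [pow_zero]
    by_contra! h
    nlinarith
  | succ e ih =>
    rw [α_succ, pow_succ]
    have := a.α_pos e; have := a.θ_lt_one; have := a.θ_pos; have := a.z_pos
    have h1 : a.θ * a.α e ≤ a.z ^ e := by nlinarith
    nlinarith

theorem Ψ_zero (e : ℕ) : a.Ψ 0 e = a.z ^ (e + 1) := by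
  unfold Ψ; ring

theorem Ψ_pos (d e : ℕ) : 0 < a.Ψ d e := by
  have := a.α_pos e; have := sub_nonneg.2 (a.α_le e); have := a.θ_pos; have := a.z_pos
  unfold Ψ
  positivity

theorem Ψ_antitone (e : ℕ) : Antitone fun d => a.Ψ d e := by
  have hz := a.z_pos
  have h1 : a.z⁻¹ ≤ 1 := inv_le_one_of_one_le₀ a.one_lt_z.le
  have h2 : a.θ * a.z⁻¹ ≤ 1 := mul_le_one₀ a.θ_lt_one.le (by positivity) h1
  have h3 := a.θ_pos
  intro d d' h
  have hp := pow_le_pow_of_le_one (by positivity) h1 h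
  have hp' := pow_le_pow_of_le_one (by positivity) h2 h
  have := a.α_pos e; have := sub_nonneg.2 (a.α_le e)
  simp only [Ψ]
  gcongr ?_ * (?_ * ?_ + ?_ * ?_)

theorem Ψ_one_zero_le : a.Ψ 1 0 ≤ a.z⁻¹ := by
  have hz := a.z_pos
  have h : a.Ψ 1 0 = a.α 0 * (1 - a.θ) + a.θ := by
    unfold Ψ
    field_simp
    ring
  linarith [a.α_zero_mul_le]

/-- A record reached during an attempt does not raise the potential. -/
theorem Ψ_record (e : ℕ) : a.Ψ (e + 2) (e + 1) ≤ a.Ψ (e + 2) e := by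
  have hz := a.z_pos
  have hθ := a.θ_pos
  have h1 := sub_pos.2 a.θ_lt_one
  have h2 := sub_pos.2 a.z_mul_θ_lt_one
  have hdiff : (a.α e - a.α (e + 1)) * (1 - a.θ) = (a.z - 1) * a.z ^ e * a.θ ^ (e + 2) := by
    rw [α_succ]
    unfold α
    field_simp
  have hle : a.α (e + 1) ≤ a.α e := by
    rw [α_succ]
    exact mul_le_of_le_one_left (a.α_pos e).le a.z_mul_θ_lt_one.le
  have hpow : a.θ ^ (e + 2) ≤ a.θ := pow_le_of_le_one hθ.le a.θ_lt_one.le (by omega)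
  have hkey : (a.z - 1) * a.z ^ e * a.θ ^ (e + 2) ≤
      (a.α e - a.α (e + 1)) * (1 - a.θ ^ (e + 2)) := by
    rw [← hdiff]
    exact mul_le_mul_of_nonneg_left (by linarith) (sub_nonneg.2 hle)
  have hform : a.Ψ (e + 2) e - a.Ψ (e + 2) (e + 1) = a.z * a.z⁻¹ ^ (e + 2) *
      ((a.α e - a.α (e + 1)) * (1 - a.θ ^ (e + 2)) - (a.z - 1) * a.z ^ e * a.θ ^ (e + 2)) := by
    unfold Ψ
    rw [mul_pow]
    ring
  rw [← sub_nonneg, hform]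
  exact mul_nonneg (by positivity) (sub_nonneg.2 hkey)

theorem Ψ_step_eq (d e : ℕ) :
    a.p * a.Ψ (d + 2) e + a.q * a.Ψ d e = a.κ * a.Ψ (d + 1) e := by
  have hz := a.z_pos.ne'
  have hp := a.p_pos.ne'
  have hroot : a.p * (a.θ * a.z⁻¹) ^ 2 + a.q = a.κ * (a.θ * a.z⁻¹) := by
    unfold θ κ
    field_simp
    ring
  have hroot' : a.p * a.z⁻¹ ^ 2 + a.q = a.κ * a.z⁻¹ := by
    unfold κ
    field_simp
  unfold Ψ
  linear_combination a.z * a.α e * a.z⁻¹ ^ d * hroot' +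
    a.z * (a.z ^ e - a.α e) * (a.θ * a.z⁻¹) ^ d * hroot

theorem Ψ_succ_max_le {d e : ℕ} (hd : 1 ≤ d) (hde : d ≤ e + 1) :
    a.Ψ (d + 1) (max e d) ≤ a.Ψ (d + 1) e := by
  rcases hde.lt_or_eq with h | rfl
  · rw [max_eq_left (by omega)]
  · rw [max_eq_right (by omega)]
    exact a.Ψ_record e

/-- The stationary bound for `E[z^g]`, where `g` is the distance of the walk to its maximum. -/
noncomputable def gapBound : ℝ := a.p / (a.p - a.q * a.z)

theorem one_le_gapBound : 1 ≤ a.gapBound := by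
  unfold gapBound
  rw [one_le_div (sub_pos.2 a.q_mul_z_lt_p)]
  linarith [mul_pos a.q_pos a.z_pos]

/-- The potential of a state after `i` letters, with the window `m, …, m + K - 1`: a bound for the
probability that the search ends without a candidate. It is discounted by `κ` for each letter of the
window that is left; before the window, `wait g` mixes `z ^ g` with the stationary bound. -/
noncomputable def potential (m K i : ℕ) : CutSearch → ℝ
  | .wait g =>
      a.κ ^ (K - (i - m)) * (a.κ ^ (m - i) * a.z ^ g + a.gapBound * (1 - a.κ ^ (m - i)))
  | .attempt d e => a.κ ^ (m + K - i) * a.Ψ d e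

theorem potential_wait_le (m K i : ℕ) {g g' : ℕ} (h : g ≤ g') :
    a.potential m K i (.wait g) ≤ a.potential m K i (.wait g') := by
  have := a.κ_pos
  have := pow_le_pow_right₀ a.one_lt_z.le h
  simp only [potential]
  gcongr

theorem potential_wait_of_le {m i : ℕ} (K : ℕ) (hm : m ≤ i) (g : ℕ) :
    a.potential m K i (.wait g) = a.κ ^ (m + K - i) * a.z ^ g := by
  rw [potential, Nat.sub_eq_zero_of_le hm, show K - (i - m) = m + K - i by omega]
  simp

theorem potential_pos (m K i : ℕ) (σ : CutSearch) : 0 < a.potential m K i σ := by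
  have := a.κ_pos
  have := a.z_pos
  cases σ with
  | wait g =>
    have h1 := sub_nonneg.2 (pow_le_one₀ (n := m - i) a.κ_pos.le a.κ_lt_one.le)
    have h2 := a.one_le_gapBound
    unfold potential
    positivity
  | attempt d e => exact mul_pos (by positivity) (a.Ψ_pos d e)

theorem one_le_potential_wait {m K i : ℕ} (hi : m + K ≤ i) (g : ℕ) :
    1 ≤ a.potential m K i (.wait g) := by
  rw [a.potential_wait_of_le K (by omega), Nat.sub_eq_zero_of_le hi, pow_zero, one_mul]
  exact one_le_pow₀ a.one_lt_z.le

theorem potential_start_le (m K : ℕ) : a.potential m K 0 (.wait 0) ≤ a.gapBound * a.κ ^ K := by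
  have h1 := pow_pos a.κ_pos m
  have h2 := a.one_le_gapBound
  have h3 := pow_pos a.κ_pos K
  simp only [potential, Nat.zero_sub, Nat.sub_zero, pow_zero, mul_one]
  rw [mul_comm]
  gcongr
  nlinarith

/-- The states that the search can be in after `i` letters. -/
def IsReachable (m i : ℕ) : CutSearch → Prop
  | .wait _ => True
  | .attempt d e => m ≤ i ∧ 1 ≤ d ∧ d ≤ e + 1

theorem isReachable_state {n : ℕ} (w : Fin n → Bool) (m K i : ℕ) :
    IsReachable m i (CutSearch.state w m K i) := by
  have h := CutSearch.describes_state w m K i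
  cases hσ : CutSearch.state w m K i with
  | wait g => trivial
  | attempt d e =>
    rw [hσ] at h
    obtain ⟨hd, hde, s, hs, -, hsi, -⟩ := h
    exact ⟨by omega, hd, hde⟩

section Step

variable {m i : ℕ} (K : ℕ) {σ : CutSearch}

theorem potential_attempt_succ_max_le {d e : ℕ} (hd : 1 ≤ d) (hde : d ≤ e + 1) :
    a.potential m K (i + 1) (.attempt (d + 1) (max e d)) ≤
      a.κ ^ (m + K - (i + 1)) * a.Ψ (d + 1) e :=
  mul_le_mul_of_nonneg_left (a.Ψ_succ_max_le hd hde) (pow_nonneg a.κ_pos.le _)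

theorem potential_attempt_down (m i d e : ℕ) (hm : m ≤ i) :
    a.potential m K (i + 1) (CutSearch.next m K i (.attempt d e) true) =
      a.κ ^ (m + K - (i + 1)) * a.Ψ (d - 1) e := by
  simp only [CutSearch.next]
  split_ifs with h1
  · rw [a.potential_wait_of_le K (by omega), h1, Nat.sub_self, Ψ_zero]
  · rfl

/-- A down step never gives a lower potential than an up step. -/
theorem potential_next_mono (hσ : IsReachable m i σ) :
    a.potential m K (i + 1) (σ.next m K i false) ≤
      a.potential m K (i + 1) (σ.next m K i true) := by
  have hκ := a.κ_pos
  match σ with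
  | .wait (g + 1) =>
    simp only [CutSearch.next]
    split_ifs
    · exact a.potential_wait_le _ _ _ (by omega)
    · exact le_rfl
  | .wait 0 =>
    simp only [CutSearch.next]
    split_ifs with ho ho'
    · rw [a.potential_wait_of_le K (by omega), potential, ← a.Ψ_zero]
      exact mul_le_mul_of_nonneg_left (a.Ψ_antitone 0 (Nat.zero_le 1)) (pow_nonneg hκ.le _)
    · omega
    · exact a.potential_wait_le _ _ _ (by omega)
    · exact le_rfl
  | .attempt d e =>
    obtain ⟨hm, hd, hde⟩ := hσ
    rw [a.potential_attempt_down K m i d e hm]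
    refine (a.potential_attempt_succ_max_le K hd hde).trans ?_
    exact mul_le_mul_of_nonneg_left (a.Ψ_antitone e (by omega)) (pow_nonneg hκ.le _)

theorem gap_step (g : ℕ) : a.p * a.z ^ g + a.q * a.z ^ (g + 2) = a.κ * a.z ^ (g + 1) := by
  have hz := a.z_pos.ne'
  unfold κ
  field_simp
  ring

theorem gap_step_zero : a.p + a.q * a.z = a.κ + (1 - a.κ) * a.gapBound := by
  have hz := a.z_pos.ne'
  have h := (sub_pos.2 a.q_mul_z_lt_p).ne'
  rw [one_sub_κ]
  unfold κ gapBound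
  field_simp
  ring

theorem potential_step (hσ : IsReachable m i σ) :
    a.p * a.potential m K (i + 1) (σ.next m K i false) +
      a.q * a.potential m K (i + 1) (σ.next m K i true) ≤ a.potential m K i σ := by
  have hκ := a.κ_pos
  have hpq := a.add_eq_one
  match σ with
  | .wait g =>
    by_cases hi : i < m + K
    · by_cases hm : m ≤ i
      · obtain ⟨r, hr⟩ : ∃ r, m + K - i = r + 1 := ⟨m + K - i - 1, by omega⟩
        have hr' : m + K - (i + 1) = r := by omega
        have hκr := pow_pos hκ r
        cases g with
        | zero =>
          simp only [CutSearch.next, if_pos hi, if_pos (And.intro hm hi)]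
          rw [a.potential_wait_of_le K (by omega), a.potential_wait_of_le K (by omega), potential,
            hr, hr', pow_succ a.κ r]
          have h1 := mul_le_mul_of_nonneg_left a.Ψ_one_zero_le a.p_pos.le
          have h2 : a.p * a.z⁻¹ + a.q * a.z = a.κ := by unfold κ; ring
          simp only [zero_add, pow_one, pow_zero, mul_one]
          have h3 := mul_le_mul_of_nonneg_left (h2 ▸ add_le_add_left h1 (a.q * a.z)) hκr.le
          linarith
        | succ g =>
          simp only [CutSearch.next, if_pos hi]
          rw [a.potential_wait_of_le K (by omega), a.potential_wait_of_le K (by omega),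
            a.potential_wait_of_le K (by omega), hr, hr']
          refine le_of_eq ?_
          linear_combination a.κ ^ r * a.gap_step g
      · -- before the window
        obtain ⟨r, hr⟩ : ∃ r, m - i = r + 1 := ⟨m - i - 1, by omega⟩
        have hr' : m - (i + 1) = r := by omega
        have hi1 : i + 1 - m = 0 := by omega
        have hi0 : i - m = 0 := by omega
        cases g with
        | zero =>
          simp only [CutSearch.next, if_pos hi, if_neg (fun h : m ≤ i ∧ i < m + K => hm h.1)]
          simp only [potential, hr, hr', hi0, hi1]
          refine le_of_eq ?_
          linear_combination a.κ ^ K * a.κ ^ r * a.gap_step_zero +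
            a.κ ^ K * a.gapBound * (1 - a.κ ^ r) * hpq
        | succ g =>
          simp only [CutSearch.next, if_pos hi]
          simp only [potential, hr, hr', hi0, hi1]
          have hbound : a.κ ^ (r + 1) ≤ a.κ ^ r :=
            pow_le_pow_of_le_one hκ.le a.κ_lt_one.le (Nat.le_succ r)
          have hK := mul_nonneg (mul_nonneg (pow_nonneg hκ.le K)
            (zero_le_one.trans a.one_le_gapBound)) (sub_nonneg.2 hbound)
          refine le_of_sub_nonneg (hK.trans_eq ?_)
          linear_combination a.κ ^ K * a.κ ^ r * a.gap_step g +
            a.κ ^ K * a.gapBound * (1 - a.κ ^ r) * hpq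
    · have hn : ∀ b, CutSearch.next m K i (.wait g) b = .wait g := by
        intro b
        cases b <;> cases g <;> simp [CutSearch.next, hi]
      rw [hn, hn, a.potential_wait_of_le K (by omega), a.potential_wait_of_le K (by omega),
        show m + K - (i + 1) = m + K - i by omega]
      refine le_of_eq ?_
      linear_combination a.κ ^ (m + K - i) * a.z ^ g * hpq
  | .attempt d e =>
    obtain ⟨hm, hd, hde⟩ := hσ
    obtain ⟨d, rfl⟩ : ∃ d', d = d' + 1 := ⟨d - 1, by omega⟩
    have hup := mul_le_mul_of_nonneg_left
      (a.potential_attempt_succ_max_le (m := m) (i := i) K hd hde) a.p_pos.le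
    have hΨ := a.Ψ_pos (d + 1) e
    have hstep := a.Ψ_step_eq d e
    have hdisc : a.κ ^ (m + K - (i + 1)) * a.κ ≤ a.κ ^ (m + K - i) := by
      rw [← pow_succ]
      exact pow_le_pow_of_le_one hκ.le a.κ_lt_one.le (by omega)
    rw [a.potential_attempt_down K m i _ e hm]
    calc _ ≤ a.κ ^ (m + K - (i + 1)) * (a.p * a.Ψ (d + 2) e + a.q * a.Ψ d e) := by
          rw [Nat.add_sub_cancel]
          simp only [CutSearch.next]
          linarith
      _ = a.κ ^ (m + K - (i + 1)) * a.κ * a.Ψ (d + 1) e := by rw [hstep, mul_assoc]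
      _ ≤ a.κ ^ (m + K - i) * a.Ψ (d + 1) e := mul_le_mul_of_nonneg_right hdisc hΨ.le

end Step

end PotentialParams

/-! ### The martingale condition -/

section Probability

variable {T : ℕ} {Ω : Type*} [MeasurableSpace Ω] {P : Measure Ω} [IsProbabilityMeasure P]
  {W : Ω → Fin T → Bool}

theorem integrable_comp_of_finite {α : Type*} [Finite α] [MeasurableSpace α]
    [MeasurableSingletonClass α] {X : Ω → α} (hX : Measurable X) (f : α → ℝ) :
    Integrable (fun ω => f (X ω)) P := by
  obtain ⟨C, hC⟩ := (Set.finite_range fun x => ‖f x‖).bddAbove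
  exact Integrable.of_bound ((measurable_of_finite f).comp hX).aestronglyMeasurable C
    (Filter.Eventually.of_forall fun ω => hC ⟨X ω, rfl⟩)

/-- The martingale condition, integrated against a nonnegative function of the past. -/
theorem MartingaleCondition.integral_indicator_mul_le {ε : ℝ} (h : MartingaleCondition ε P W)
    (hW : Measurable W) (t : Fin T) {f : (Fin T → Bool) → ℝ} (hf : ∀ w, 0 ≤ f w)
    (hpast : ∀ w w', (∀ j < t, w j = w' j) → f w = f w') :
    ∫ ω, (if W ω t = true then 1 else 0) * f (W ω) ∂P ≤
      (1 - ε) / 2 * ∫ ω, f (W ω) ∂P := by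
  set past : Ω → {j : Fin T // j < t} → Bool := fun ω j => W ω j
  have hpm : Measurable past :=
    measurable_pi_lambda _ fun j => (measurable_pi_apply (j : Fin T)).comp hW
  set ind : Ω → ℝ := fun ω => if W ω t = true then (1 : ℝ) else 0
  -- `f` factors through the past
  set f' : ({j : Fin T // j < t} → Bool) → ℝ := fun v =>
    f fun j => if hj : j < t then v ⟨j, hj⟩ else false
  set g : Ω → ℝ := fun ω => f (W ω)
  have hfg : g = fun ω => f' (past ω) := by
    funext ω
    exact hpast _ _ fun j hj => by simp [past, hj]
  have hind : Integrable ind P := integrable_comp_of_finite hW fun w => if w t = true then 1 else 0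
  have hgi : Integrable g P := integrable_comp_of_finite hW f
  have hgind : Integrable (g * ind) P :=
    integrable_comp_of_finite hW fun w => f w * if w t = true then 1 else 0
  have hgm : StronglyMeasurable[MeasurableSpace.comap past inferInstance] g := by
    rw [hfg]
    exact ((measurable_of_finite f').comp (comap_measurable past)).stronglyMeasurable
  have hpull := condExp_mul_of_stronglyMeasurable_left hgm hgind hind
  calc ∫ ω, (if W ω t = true then 1 else 0) * f (W ω) ∂P = ∫ ω, (g * ind) ω ∂P :=
        integral_congr_ae (Filter.Eventually.of_forall fun ω => mul_comm _ _)
    _ = ∫ ω, (P[g * ind | MeasurableSpace.comap past inferInstance]) ω ∂P :=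
        (integral_condExp hpm.comap_le).symm
    _ ≤ ∫ ω, (1 - ε) / 2 * g ω ∂P := by
        refine integral_mono_ae integrable_condExp (hgi.const_mul _) ?_
        filter_upwards [hpull, h t] with ω h1 h2
        rw [h1, Pi.mul_apply, mul_comm]
        exact mul_le_mul_of_nonneg_right h2 (hf _)
    _ = (1 - ε) / 2 * ∫ ω, f (W ω) ∂P := integral_const_mul _ _

/-- Along the search for a cut, the potential is a supermartingale. -/
theorem MartingaleCondition.integral_potential_le {a : PotentialParams}
    (h : MartingaleCondition (1 - 2 * a.q) P W) (hW : Measurable W) (m K : ℕ) {i : ℕ}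
    (hi : i ≤ T) :
    ∫ ω, a.potential m K i (CutSearch.state (W ω) m K i) ∂P ≤
      a.potential m K 0 (CutSearch.wait 0) := by
  induction i with
  | zero => simp [CutSearch.state]
  | succ i ih =>
    refine le_trans ?_ (ih (by omega))
    set st : (Fin T → Bool) → CutSearch := fun w => CutSearch.state w m K i
    set up : (Fin T → Bool) → ℝ := fun w =>
      a.potential m K (i + 1) ((st w).next m K i false)
    set down : (Fin T → Bool) → ℝ := fun w =>
      a.potential m K (i + 1) ((st w).next m K i true)
    have hreach : ∀ w, PotentialParams.IsReachable m i (st w) := fun w =>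
      PotentialParams.isReachable_state w m K i
    have hle := h.integral_indicator_mul_le hW ⟨i, hi⟩ (f := fun w => down w - up w)
      (fun w => sub_nonneg.2 (a.potential_next_mono K (hreach w)))
      (fun w w' hww => by
        have : st w = st w' := CutSearch.state_congr m K fun j hj => hww j hj
        simp only [up, down, this])
    have hint := fun f : (Fin T → Bool) → ℝ => integrable_comp_of_finite (P := P) hW f
    have hup := hint up
    have hdiff := hint fun w => down w - up w
    calc ∫ ω, a.potential m K (i + 1) (CutSearch.state (W ω) m K (i + 1)) ∂P
        = ∫ ω, up (W ω) + (if W ω ⟨i, hi⟩ = true then 1 else 0) * (down (W ω) - up (W ω)) ∂P := by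
          congr 1
          funext ω
          rw [CutSearch.state, letter, dif_pos (show i < T from hi)]
          cases hb : W ω ⟨i, hi⟩ <;> simp [up, down, st]
      _ = ∫ ω, up (W ω) ∂P +
            ∫ ω, (if W ω ⟨i, hi⟩ = true then 1 else 0) * (down (W ω) - up (W ω)) ∂P :=
          integral_add hup
            (hint fun w => (if w ⟨i, hi⟩ = true then 1 else 0) * (down w - up w))
      _ ≤ ∫ ω, up (W ω) ∂P + a.q * ∫ ω, (down (W ω) - up (W ω)) ∂P := by
          refine add_le_add_right (hle.trans_eq ?_) _
          ring
      _ = ∫ ω, up (W ω) + a.q * (down (W ω) - up (W ω)) ∂P := by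
          rw [integral_add hup (hdiff.const_mul _), integral_const_mul]
      _ ≤ ∫ ω, a.potential m K i (CutSearch.state (W ω) m K i) ∂P := by
          refine integral_mono (hup.add (hdiff.const_mul _))
            (hint fun w => a.potential m K i (st w)) fun ω => ?_
          refine le_trans (le_of_eq ?_) (a.potential_step K (hreach (W ω)))
          simp only [up, down]
          linear_combination (-a.potential m K (i + 1) ((st (W ω)).next m K i false)) *
            a.add_eq_one

theorem MartingaleCondition.measureReal_no_isCut_le {a : PotentialParams}
    (h : MartingaleCondition (1 - 2 * a.q) P W) (hW : Measurable W) {m K : ℕ} (hK : m + K ≤ T) :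
    P.real {ω | ∀ s, m ≤ s → s < m + K → ¬ IsCut (W ω) s} ≤ a.gapBound * a.κ ^ K := by
  set V : Ω → ℝ := fun ω => a.potential m K T (CutSearch.state (W ω) m K T)
  have hV : Integrable V P :=
    integrable_comp_of_finite hW fun w => a.potential m K T (CutSearch.state w m K T)
  calc P.real {ω | ∀ s, m ≤ s → s < m + K → ¬ IsCut (W ω) s} ≤ P.real {ω | 1 ≤ V ω} := by
        refine measureReal_mono fun ω hω => ?_
        cases hσ : CutSearch.state (W ω) m K T with
        | wait g =>
          simp only [Set.mem_ofPred_eq, V, hσ]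
          exact a.one_le_potential_wait hK g
        | attempt d e =>
          obtain ⟨s, hs, hs', hcut⟩ := CutSearch.exists_isCut_of_state_eq_attempt hσ
          exact absurd hcut (hω s hs hs')
    _ ≤ ∫ ω, V ω ∂P := by
        have := mul_meas_ge_le_integral_of_nonneg
          (Filter.Eventually.of_forall fun ω => (a.potential_pos m K T _).le) hV 1
        rwa [one_mul] at this
    _ ≤ a.potential m K 0 (CutSearch.wait 0) := h.integral_potential_le hW m K le_rfl
    _ ≤ a.gapBound * a.κ ^ K := a.potential_start_le m K

end Probability

/-! ### The choice of the tilt -/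

theorem sub_one_le_of_tilt {ε : ℝ} (h0 : 0 < ε) (h1 : ε < 1) :
    (1 - ε) / 2 / ((1 + ε) / 2) * (1 + ε ^ 2 / 8) ^ 3 ≤ 1 - ε / 2 := by
  have hδ : (1 + ε ^ 2 / 8) ^ 3 ≤ 1 + ε ^ 2 / 2 := by
    have h2 : ε ^ 2 ≤ 1 := by nlinarith
    have h3 : 0 ≤ ε ^ 2 := sq_nonneg ε
    generalize ε ^ 2 = x at *
    nlinarith [mul_nonneg h3 (sub_nonneg.2 h2), mul_nonneg h3 (mul_nonneg h3 (sub_nonneg.2 h2))]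
  have hθ : (1 - ε) / 2 / ((1 + ε) / 2) ≤ 1 - ε := by
    rw [div_le_iff₀ (by linarith)]
    nlinarith
  calc _ ≤ (1 - ε) * (1 + ε ^ 2 / 2) := by
        gcongr
    _ ≤ 1 - ε / 2 := by nlinarith [mul_pos h0 h0, mul_pos h0 (mul_pos h0 h0)]

/-- The parameters for the bias `ε`: `z - 1` has the order `ε ^ 2`, small enough for an attempt to
pay off: it succeeds with a probability of order `ε`, but it may raise the record by an amount of
order `1 / ε` before it fails. -/
noncomputable def PotentialParams.ofBias {ε : ℝ} (h0 : 0 < ε) (h1 : ε < 1) : PotentialParams where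
  p := (1 + ε) / 2
  q := (1 - ε) / 2
  z := 1 + ε ^ 2 / 8
  q_pos := by linarith
  add_eq_one := by ring
  one_lt_z := by
    have := pow_pos h0 2
    linarith
  lt_p := by
    have h := sub_one_le_of_tilt h0 h1
    rw [div_mul_eq_mul_div, div_le_iff₀ (by linarith)] at h
    nlinarith
  sub_one_le := by
    have h := sub_one_le_of_tilt h0 h1
    nlinarith

namespace PotentialParams

variable {ε : ℝ}

theorem half_le_drift (h0 : 0 < ε) (h1 : ε < 1) :
    ε / 2 ≤ (1 + ε) / 2 - (1 - ε) / 2 * (1 + ε ^ 2 / 8) := by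
  nlinarith [mul_pos h0 h0, mul_pos h0 (mul_pos h0 h0)]

theorem gapBound_ofBias_le (h0 : 0 < ε) (h1 : ε < 1) : (ofBias h0 h1).gapBound ≤ 2 / ε := by
  have := half_le_drift h0 h1
  simp only [gapBound, ofBias]
  rw [div_le_div_iff₀ (by linarith) h0]
  nlinarith

theorem κ_ofBias_le (h0 : 0 < ε) (h1 : ε < 1) : (ofBias h0 h1).κ ≤ Real.exp (-(ε ^ 3 / 18)) := by
  have h2 : ε ^ 3 / 18 ≤ 1 - (ofBias h0 h1).κ := by
    have := half_le_drift h0 h1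
    rw [one_sub_κ]
    simp only [ofBias]
    have h3 : 0 < ε ^ 2 := pow_pos h0 2
    have h4 : ε ^ 2 ≤ 1 := by nlinarith
    rw [le_div_iff₀ (by linarith)]
    calc ε ^ 3 / 18 * (1 + ε ^ 2 / 8) ≤ ε ^ 3 / 18 * (9 / 8) := by
          gcongr
          linarith
      _ = (1 + ε ^ 2 / 8 - 1) * (ε / 2) := by ring
      _ ≤ _ := by
          gcongr
          linarith
  have := Real.add_one_le_exp (-(ε ^ 3 / 18))
  linarith

end PotentialParams

/-- The factor `2 / ε` is absorbed by halving the rate: if `k ≤ 2 / ε`, then the claimed bound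
exceeds `1`; otherwise `2 / ε ≤ k ≤ T`, and the claim follows from `x ^ 2 ≤ x`. -/
theorem le_mul_exp_of_le {ε x : ℝ} {T k : ℕ} (h0 : 0 < ε) (h1 : ε < 1) (hT : k + 1 ≤ T)
    (hT2 : 2 ≤ T) (hx0 : 0 ≤ x) (hx1 : x ≤ 1)
    (hx : x ≤ T * (2 / ε * Real.exp (-(ε ^ 3 / 18)) ^ k)) :
    x ≤ T * Real.exp (-(1 / 36 * ε ^ 3 * k)) := by
  have hT2' : (2 : ℝ) ≤ T := by exact_mod_cast hT2
  have hTk : (k : ℝ) + 1 ≤ T := by exact_mod_cast hT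
  rcases le_total (k : ℝ) (2 / ε) with hk | hk
  · have h2 : 1 / 36 * ε ^ 3 * k ≤ 1 / 2 := by
      calc 1 / 36 * ε ^ 3 * k ≤ 1 / 36 * ε ^ 3 * (2 / ε) := by gcongr
        _ = ε ^ 2 / 18 := by field_simp; norm_num
        _ ≤ 1 / 2 := by nlinarith
    have h3 := Real.add_one_le_exp (-(1 / 36 * ε ^ 3 * k))
    nlinarith
  · refine le_of_sq_le_sq ?_ (by positivity)
    calc x ^ 2 ≤ x := by nlinarith
      _ ≤ T * (2 / ε * Real.exp (-(ε ^ 3 / 18)) ^ k) := hx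
      _ ≤ T * (T * Real.exp (-(ε ^ 3 / 18)) ^ k) := by
          gcongr
          linarith
      _ = (T * Real.exp (-(1 / 36 * ε ^ 3 * k))) ^ 2 := by
          rw [mul_pow, ← Real.exp_nat_mul, ← Real.exp_nat_mul, sq (T : ℝ), mul_assoc]
          congr 3
          push_cast
          ring

theorem theorem2 :
    ∃ c C : ℝ, 0 < c ∧ 0 ≤ C ∧ C ≤ 1 ∧
      ∀ (ε : ℝ), 0 < ε → ε < 1 → ∀ (T k : ℕ)
        (Ω : Type*) [MeasurableSpace Ω] (P : Measure Ω) [IsProbabilityMeasure P]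
        (W : Ω → Fin T → Bool), Measurable W → MartingaleCondition ε P W →
          P.real {ω | ViolatesCP k (W ω)} ≤ P.real {ω | ViolatesSlotCP k (W ω)} ∧
          P.real {ω | ViolatesSlotCP k (W ω)} ≤
            T * Real.exp (-(c * (ε ^ 3 * (1 - C * ε)) * k)) := by
  refine ⟨1 / 36, 0, by norm_num, le_rfl, zero_le_one, ?_⟩
  intro ε h0 h1 T k Ω _ P _ W hW hM
  refine ⟨measureReal_mono fun ω hω => ViolatesCP.violatesSlotCP hω, ?_⟩
  rw [zero_mul, sub_zero, mul_one]
  set a := PotentialParams.ofBias h0 h1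
  have hM' : MartingaleCondition (1 - 2 * a.q) P W := by
    have : 1 - 2 * a.q = ε := by
      simp only [a, PotentialParams.ofBias]
      ring
    rwa [this]
  have hunion : P.real {ω | ViolatesSlotCP k (W ω)} ≤
      ((T - k : ℕ) : ℝ) * (a.gapBound * a.κ ^ (k + 1)) := by
    calc P.real {ω | ViolatesSlotCP k (W ω)} ≤ P.real (⋃ m ∈ Finset.range (T - k),
            {ω | ∀ s, m ≤ s → s < m + (k + 1) → ¬ IsCut (W ω) s}) := by
          refine measureReal_mono (fun ω hω => ?_) (measure_ne_top P _)
          obtain ⟨m, hm, hcut⟩ := ViolatesSlotCP.exists_window hω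
          exact Set.mem_biUnion (Finset.mem_coe.2 (Finset.mem_range.2 hm)) hcut
      _ ≤ ∑ m ∈ Finset.range (T - k),
            P.real {ω | ∀ s, m ≤ s → s < m + (k + 1) → ¬ IsCut (W ω) s} :=
          measureReal_biUnion_finset_le _ _
      _ ≤ ∑ m ∈ Finset.range (T - k), a.gapBound * a.κ ^ (k + 1) := by
          refine Finset.sum_le_sum fun m hm => hM'.measureReal_no_isCut_le hW ?_
          rw [Finset.mem_range] at hm
          omega
      _ = ((T - k : ℕ) : ℝ) * (a.gapBound * a.κ ^ (k + 1)) := by simp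
  rcases le_or_gt T k with hT | hT
  · rw [Nat.sub_eq_zero_of_le hT, Nat.cast_zero, zero_mul] at hunion
    exact hunion.trans (by positivity)
  rcases Nat.eq_zero_or_pos k with rfl | hk
  · have hT1 : (1 : ℝ) ≤ T := by exact_mod_cast hT
    simpa using measureReal_le_one.trans hT1
  refine le_mul_exp_of_le h0 h1 hT (by omega) measureReal_nonneg measureReal_le_one
    (hunion.trans ?_)
  have hκ := a.κ_pos
  have hgap := zero_le_one.trans a.one_le_gapBound
  gcongr
  · exact Nat.sub_le T k
  · exact PotentialParams.gapBound_ofBias_le h0 h1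
  · exact (pow_le_pow_of_le_one hκ.le a.κ_lt_one.le (Nat.le_succ k)).trans
      (pow_le_pow_left₀ hκ.le (PotentialParams.κ_ofBias_le h0 h1) k)
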